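/- Let $\mathbb U$ be a (real or complex) Banach Lie group: a group that is also an analytic manifold, without boundary, modelled on a real or complex Banach space, with analytic multiplication and inversion. Let $d$ be a left-invariant or right-invariant metric on $\mathbb U$ that induces its topology. Let $S\subseteq\mathbb U$ be ad-bounded, meaning that the set of operators $\mathrm{Ad}(S)\subset GL(\mathfrak u)$ on the Lie algebra $\mathfrak u=\mathrm{Lie}(\mathbb U)$ is bounded: $\sup_{g\in S}\|\mathrm{Ad}_g\|<\infty$ for one (equivalently, every) norm on $\mathfrak u$ defining its Banach space topology. Then for every $\varepsilon>0$ there is $\delta>0$ such that, for every compact topological group $\mathbb K$ and every continuous map $\varphi:\mathbb K\to\mathbb U$ with $\varphi(\mathbb K)\subseteq S$ and $$d\bigl(\varphi(st),\,\varphi(s)\varphi(t)\bigr)<\delta\qquad\text{for all } s,t\in\mathbb K,$$ there is a continuous group morphism $\psi:\mathbb K\to\mathbb U$ with $d(\varphi(s),\psi(s))<\varepsilon$ for all $s\in\mathbb K$. In particular $\delta$ does not depend on $\mathbb K$ or $\varphi$. -/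

import Mathlib

open scoped Manifold ContDiff

/-- The adjoint representation of a Lie group `U` modelled on `E`: `Ad g` is the derivative at `1`
of the conjugation `x ↦ g * x * g⁻¹`, an endomorphism of the Lie algebra `T₁U`. In Mathlib `T₁U` is
a copy of the model space `E`, identified with it by the preferred chart at `1`, and `Ad g` is
recorded as an operator on `E`, so that it has an operator norm. -/
noncomputable def lieAd (𝕜 : Type*) [RCLike 𝕜] {E : Type*} [NormedAddCommGroup E] [NormedSpace 𝕜 E]
    {U : Type*} [TopologicalSpace U] [ChartedSpace E U] [Group U] (g : U) : E →L[𝕜] E :=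
  (mfderiv 𝓘(𝕜, E) 𝓘(𝕜, E) (fun x : U => g * x * g⁻¹) (1 : U) :)

/-- `S ⊆ U` is ad-bounded: the operators `Ad g`, `g ∈ S`, are uniformly bounded. -/
def IsAdBounded (𝕜 : Type*) [RCLike 𝕜] {E : Type*} [NormedAddCommGroup E] [NormedSpace 𝕜 E]
    {U : Type*} [TopologicalSpace U] [ChartedSpace E U] [Group U] (S : Set U) : Prop :=
  ∃ C : ℝ, ∀ g ∈ S, ‖lieAd 𝕜 (E := E) g‖ ≤ C

/-- `φ` is a `δ`-morphism: `d (φ (s t), φ s φ t) < δ` for all `s, t`. -/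
def IsDeltaMorphism {K U : Type*} [Group K] [Group U] [MetricSpace U] (δ : ℝ) (φ : K → U) : Prop :=
  ∀ s t : K, dist (φ (s * t)) (φ s * φ t) < δ

/-- The metric of `U` is left-invariant or right-invariant. -/
def IsLeftOrRightInvariantMetric (U : Type*) [Group U] [MetricSpace U] : Prop :=
  (∀ a x y : U, dist (a * x) (a * y) = dist x y) ∨ (∀ a x y : U, dist (x * a) (y * a) = dist x y)

open Filter Topology Metric Set

/-! The proof is a Newton iteration on the defect α(s,t) = φ(s)φ(t)φ(st)⁻¹. In a chart at 1,
associativity says that the coordinate a of an ε-small α is a 2-cocycle for Ad∘φ up to O(ε²). Put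
b(s) = ∫ a(s,t) dt, the Haar average. Integrating the cocycle relation in the last variable and
using left invariance gives a(r,s) = Ad(φ(r)) b(s) + b(r) − b(rs) + O(ε²). Hence, if β has
coordinate b, the map β⁻¹φ has defect O(ε²); this is `exists_correction`.

The implied constants depend on φ only through a bound for Ad on its image. Ad-boundedness supplies
the bound, and it survives the iteration because the accumulated corrections stay in a fixed
neighbourhood of 1, where ‖Ad‖ ≤ 2. It enters through `exists_norm_conj_sub_le`, a second-order
estimate for conjugation that is uniform in g. The corrections converge uniformly in coordinates,
and the limit has trivial defect (`exists_morphism_near`).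

A right-invariant metric measures α directly; a left-invariant one measures a conjugate of it, which
`exists_conj_mem` handles. -/

/-- A chart of a topological group around `1` in which multiplication and inversion agree with
addition and negation up to quadratic errors, together with the derivatives at `1` of the
conjugations. -/
structure QuadraticChart (U E : Type*) [TopologicalSpace U] [Group U] [NormedAddCommGroup E]
    [NormedSpace ℝ E] where
  chart : OpenPartialHomeomorph U E
  ad : U → E →L[ℝ] E
  r : ℝ
  M : ℝ
  r_pos : 0 < r
  M_nonneg : 0 ≤ M
  M_mul_r_le : M * r ≤ 1 / 8
  one_mem : 1 ∈ chart.source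
  map_one : chart 1 = 0
  closedBall_subset : closedBall 0 r ⊆ chart.target
  isClosed_setOf : ∀ ρ ≤ r, IsClosed {x | x ∈ chart.source ∧ ‖chart x‖ ≤ ρ}
  mul_mem : ∀ x ∈ chart.source, ∀ y ∈ chart.source, ‖chart x‖ ≤ r → ‖chart y‖ ≤ r →
    x * y ∈ chart.source
  norm_mul : ∀ x ∈ chart.source, ∀ y ∈ chart.source, ‖chart x‖ ≤ r → ‖chart y‖ ≤ r →
    ‖chart (x * y) - chart x - chart y‖ ≤ M * ‖chart x‖ * ‖chart y‖
  inv_mem : ∀ x ∈ chart.source, ‖chart x‖ ≤ r → x⁻¹ ∈ chart.source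
  norm_inv : ∀ x ∈ chart.source, ‖chart x‖ ≤ r → ‖chart x⁻¹ + chart x‖ ≤ M * ‖chart x‖ ^ 2
  hasFDerivAt_conj : ∀ g, HasFDerivAt (fun v => chart (g * chart.symm v * g⁻¹)) (ad g) 0

/-! ### Adjoint operators and conjugation in a quadratic chart -/

namespace QuadraticChart

variable {U E : Type*} [TopologicalSpace U] [Group U] [NormedAddCommGroup E] [NormedSpace ℝ E]
  (c : QuadraticChart U E)

/-- The elements of the chart domain whose coordinates have norm at most `ρ`. -/
def nbhd (ρ : ℝ) : Set U := {x | x ∈ c.chart.source ∧ ‖c.chart x‖ ≤ ρ}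

variable {c}

theorem nbhd_mono {ρ σ : ℝ} (h : ρ ≤ σ) : c.nbhd ρ ⊆ c.nbhd σ := fun _ hx => ⟨hx.1, hx.2.trans h⟩

theorem one_mem_nbhd {ρ : ℝ} (h : 0 ≤ ρ) : (1 : U) ∈ c.nbhd ρ :=
  ⟨c.one_mem, by simpa [c.map_one] using h⟩

theorem nbhd_mem_nhds {ρ : ℝ} (h : 0 < ρ) : c.nbhd ρ ∈ 𝓝 (1 : U) := by
  have h1 := c.chart.continuousAt c.one_mem
  rw [ContinuousAt, c.map_one] at h1
  filter_upwards [c.chart.open_source.mem_nhds c.one_mem, h1 (closedBall_mem_nhds 0 h)] with x hx hx'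
  exact ⟨hx, by simpa using hx'⟩

theorem symm_zero : c.chart.symm 0 = 1 := by
  rw [← c.map_one, c.chart.left_inv c.one_mem]

theorem mem_target {v : E} (hv : ‖v‖ ≤ c.r) : v ∈ c.chart.target :=
  c.closedBall_subset (by simpa using hv)

theorem apply_symm {v : E} (hv : ‖v‖ ≤ c.r) : c.chart (c.chart.symm v) = v :=
  c.chart.right_inv (mem_target hv)

theorem symm_mem {v : E} (hv : ‖v‖ ≤ c.r) : c.chart.symm v ∈ c.nbhd ‖v‖ :=
  ⟨c.chart.map_target (mem_target hv), by rw [apply_symm hv]⟩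

theorem continuousAt_symm {v : E} (hv : ‖v‖ ≤ c.r) : ContinuousAt c.chart.symm v :=
  c.chart.continuousAt_symm (mem_target hv)

theorem tendsto_symm : Tendsto c.chart.symm (𝓝 0) (𝓝 (1 : U)) := by
  have := continuousAt_symm (c := c) (v := 0) (by simpa using c.r_pos.le)
  rwa [ContinuousAt, symm_zero] at this

theorem exists_nbhd_subset {W : Set U} (hW : W ∈ 𝓝 (1 : U)) :
    ∃ ρ, 0 < ρ ∧ ρ ≤ c.r ∧ c.nbhd ρ ⊆ W := by
  obtain ⟨ρ, hρ, h⟩ := Metric.mem_nhds_iff.1 (tendsto_symm (c := c) hW)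
  refine ⟨min (ρ / 2) c.r, lt_min (by positivity) c.r_pos, min_le_right _ _, fun x hx => ?_⟩
  have h2 : c.chart x ∈ ball (0 : E) ρ := by
    simpa using (hx.2.trans (min_le_left _ _)).trans_lt (half_lt_self hρ)
  have := h h2
  rwa [mem_preimage, c.chart.left_inv hx.1] at this

variable [IsTopologicalGroup U]

theorem ad_mul (g h : U) : c.ad (g * h) = (c.ad g).comp (c.ad h) := by
  have h0 : c.chart (h * c.chart.symm 0 * h⁻¹) = 0 := by simp [symm_zero, c.map_one]
  have h1 : HasFDerivAt (fun v => c.chart (g * c.chart.symm v * g⁻¹)) (c.ad g)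
      (c.chart (h * c.chart.symm 0 * h⁻¹)) := by
    rw [h0]; exact c.hasFDerivAt_conj g
  have h2 := h1.comp 0 (c.hasFDerivAt_conj h)
  refine (c.hasFDerivAt_conj (g * h)).unique (h2.congr_of_eventuallyEq ?_)
  have h3 : Tendsto (fun v => h * c.chart.symm v * h⁻¹) (𝓝 0) (𝓝 1) := by
    have := (tendsto_symm (c := c)).const_mul h |>.mul_const h⁻¹
    simpa using this
  filter_upwards [h3 (c.chart.open_source.mem_nhds c.one_mem)] with v hv
  simp only [Function.comp]
  rw [c.chart.left_inv hv]
  simp only [mul_inv_rev, mul_assoc]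

/-- With z = wyw⁻¹, expanding both sides of zw = wy in the chart bounds ‖z‖ by (9/8)‖y‖ + (1/8)‖z‖,
since M r ≤ 1/8. So conjugation by w is 2-Lipschitz at 1. -/
theorem norm_ad_le_two {w : U} (hw : w ∈ c.nbhd c.r) : ‖c.ad w‖ ≤ 2 := by
  refine (c.hasFDerivAt_conj w).le_of_lip' (by norm_num) ?_
  have h3 : Tendsto (fun v => w * c.chart.symm v * w⁻¹) (𝓝 0) (𝓝 1) := by
    have := (tendsto_symm (c := c)).const_mul w |>.mul_const w⁻¹
    simpa using this
  filter_upwards [h3 (nbhd_mem_nhds (c := c) c.r_pos), closedBall_mem_nhds (0 : E) c.r_pos] with v hv hvr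
  replace hvr : ‖v‖ ≤ c.r := by simpa using hvr
  have hy := symm_mem (c := c) hvr
  have hyv : c.chart (c.chart.symm v) = v := apply_symm hvr
  set y := c.chart.symm v
  set z := w * y * w⁻¹
  have hz : z * w = w * y := by simp [z]
  have e1 := c.norm_mul z hv.1 w hw.1 hv.2 hw.2
  have e2 := c.norm_mul w hw.1 y hy.1 hw.2 (hy.2.trans hvr)
  rw [hz] at e1
  have hMw : c.M * ‖c.chart w‖ ≤ 1 / 8 :=
    (mul_le_mul_of_nonneg_left hw.2 c.M_nonneg).trans c.M_mul_r_le
  have e3 : ‖c.chart z‖ ≤ ‖v‖ + (c.M * ‖c.chart w‖ * ‖v‖ + c.M * ‖c.chart z‖ * ‖c.chart w‖) := by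
    have : c.chart z = v + ((c.chart (w * y) - c.chart w - c.chart y) -
        (c.chart (w * y) - c.chart z - c.chart w)) := by rw [hyv]; abel
    calc ‖c.chart z‖ = _ := congrArg _ this
      _ ≤ _ := (norm_add_le _ _).trans (add_le_add_right ((norm_sub_le _ _).trans
        (add_le_add (by rw [← hyv] at *; exact e2) e1)) _)
  have : c.chart (w * c.chart.symm 0 * w⁻¹) = 0 := by simp [symm_zero, c.map_one]
  rw [this, sub_zero, sub_zero]
  nlinarith [norm_nonneg v, norm_nonneg (c.chart z), mul_le_mul_of_nonneg_right hMw (norm_nonneg v),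
    mul_le_mul_of_nonneg_right hMw (norm_nonneg (c.chart z))]

theorem norm_ad_mul_le {w g : U} {C : ℝ} (hw : w ∈ c.nbhd c.r) (hg : ‖c.ad g‖ ≤ C) :
    ‖c.ad (w * g)‖ ≤ 2 * C := by
  rw [ad_mul]
  exact (ContinuousLinearMap.opNorm_comp_le _ _).trans
    (mul_le_mul (norm_ad_le_two hw) hg (norm_nonneg _) (by norm_num))

/-- Conjugation by `g` is uniformly close to `Ad g` in the chart when `‖Ad g‖` is bounded. -/
theorem exists_norm_conj_sub_le (c : QuadraticChart U E) {C : ℝ} (hC : 0 ≤ C) :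
    ∃ ρ A : ℝ, 0 < ρ ∧ ρ ≤ c.r ∧ 0 ≤ A ∧ ∀ g, ‖c.ad g‖ ≤ C → ∀ x ∈ c.nbhd ρ,
      g * x * g⁻¹ ∈ c.chart.source ∧
        ‖c.chart (g * x * g⁻¹) - c.ad g (c.chart x)‖ ≤ A * ‖c.chart x‖ ^ 2 := by
  have hM := c.M_nonneg
  have hr := c.r_pos
  -- The three terms are the error rates of `n4` (differentiability of the conjugation), `n3`
  -- (coordinates of the increment) and `n7` (the product in the image).
  set A := 2 + 2 * C * c.M + 2 * c.M * (C + 1) ^ 2 with hA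
  have hA0 : 0 < A := by positivity
  -- The second bound gives A‖v‖ ≤ 1, hence image coordinates of norm at most (C+1)‖v‖; the first
  -- keeps these within r.
  refine ⟨min (c.r / (C + 1)) (1 / A), A, by positivity,
    (min_le_left _ _).trans (div_le_self hr.le (by linarith)), hA0.le, fun g hg x hx => ?_⟩
  obtain ⟨hxs, hx⟩ := hx
  set v := c.chart x with hv
  have hxv : c.chart.symm v = x := c.chart.left_inv hxs
  have hCr : (C + 1) * ‖v‖ ≤ c.r := by
    have := hx.trans (min_le_left _ _)
    rw [le_div_iff₀ (by linarith)] at this; linarith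
  have hAv : A * ‖v‖ ≤ 1 := by
    have := hx.trans (min_le_right _ _)
    rw [le_div_iff₀ hA0] at this; linarith
  have hvr : ‖v‖ ≤ c.r := by nlinarith [norm_nonneg v]
  have hMv : c.M * ‖v‖ ≤ 1 / 8 := (mul_le_mul_of_nonneg_left hvr hM).trans c.M_mul_r_le
  rcases eq_or_ne v 0 with h0 | h0
  · have : x = 1 := by rw [← hxv, h0, symm_zero]
    subst this
    simp [c.one_mem, c.map_one, h0]
  have hv0 : 0 < ‖v‖ := norm_pos_iff.2 h0
  have hnorm : ∀ t ∈ Icc (0 : ℝ) 1, ‖t • v‖ = t * ‖v‖ := fun t ht => by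
    rw [norm_smul, Real.norm_of_nonneg ht.1]
  have htr : ∀ t ∈ Icc (0 : ℝ) 1, ‖t • v‖ ≤ c.r := fun t ht => by
    rw [hnorm t ht]; nlinarith [ht.1, ht.2]
  set y : ℝ → U := fun t => c.chart.symm (t • v) with hy
  have hyc : ∀ t ∈ Icc (0 : ℝ) 1, ContinuousAt y t := fun t ht =>
    ContinuousAt.comp (g := c.chart.symm) (continuousAt_symm (htr t ht)) (by fun_prop)
  set f : ℝ → U := fun t => g * y t * g⁻¹ with hf
  have hfc : ContinuousOn f (Icc 0 1) := fun t ht =>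
    ((continuousAt_const.mul (hyc t ht)).mul continuousAt_const).continuousWithinAt
  set s : Set ℝ := {t | f t ∈ c.nbhd c.r ∧
    ‖c.chart (f t) - t • c.ad g v‖ ≤ A * t * ‖v‖ ^ 2} with hs
  have hAdv : ‖c.ad g v‖ ≤ C * ‖v‖ := c.ad g |>.le_of_opNorm_le hg v
  -- Continuous induction along the ray t ↦ tv. Differentiability at 0 is not uniform in g, but
  -- conjugation is a homomorphism, so each small increment y(t)⁻¹y(τ) can be moved to 1 and treated
  -- there. Closedness of `c.nbhd c.r` in U keeps limits inside the chart domain.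
  have key : Icc (0 : ℝ) 1 ⊆ s := by
    refine IsClosed.Icc_subset_of_forall_exists_gt ?_ ?_ ?_
    · have h1 : IsClosed (Icc (0 : ℝ) 1 ∩ f ⁻¹' c.nbhd c.r) :=
        hfc.preimage_isClosed_of_isClosed isClosed_Icc (c.isClosed_setOf _ le_rfl)
      have h2 : ContinuousOn (fun t => ‖c.chart (f t) - t • c.ad g v‖ - A * t * ‖v‖ ^ 2)
          (Icc (0 : ℝ) 1 ∩ f ⁻¹' c.nbhd c.r) := by
        have : ContinuousOn (fun t => c.chart (f t)) (Icc (0 : ℝ) 1 ∩ f ⁻¹' c.nbhd c.r) :=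
          c.chart.continuousOn.comp (hfc.mono inter_subset_left) fun t ht => ht.2.1
        fun_prop
      have h3 := h2.preimage_isClosed_of_isClosed h1 (isClosed_Iic (a := 0))
      convert h3 using 1
      ext t
      simp only [hs, mem_inter_iff, mem_ofPred_eq, mem_preimage, mem_Iic, sub_nonpos]
      tauto
    · have : f 0 = 1 := by simp [hf, hy, symm_zero]
      simp only [hs, mem_ofPred_eq, this]
      exact ⟨one_mem_nbhd hr.le, by simp [c.map_one]⟩
    · rintro t ⟨⟨hfr, hft⟩, ht⟩ u hu
      have ht' : t ∈ Icc (0 : ℝ) 1 := ⟨ht.1, ht.2.le⟩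
      have hg1 : Tendsto (fun ζ => g * c.chart.symm ζ * g⁻¹) (𝓝 0) (𝓝 1) := by
        have := (tendsto_symm (c := c)).const_mul g |>.mul_const g⁻¹
        simpa using this
      -- Tolerance ‖v‖ in the little-o makes the accumulated error quadratic in v.
      have hder := (c.hasFDerivAt_conj g).isLittleO.def hv0
      have hz : Tendsto (fun τ => (y t)⁻¹ * y τ) (𝓝[>] t) (𝓝 1) := by
        have : Tendsto (fun τ => (y t)⁻¹ * y τ) (𝓝 t) (𝓝 ((y t)⁻¹ * y t)) :=
          (hyc t ht').tendsto.const_mul _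
        rw [inv_mul_cancel] at this
        exact this.mono_left nhdsWithin_le_nhds
      have hzc : Tendsto (fun τ => c.chart ((y t)⁻¹ * y τ)) (𝓝[>] t) (𝓝 0) := by
        have := (c.chart.continuousAt c.one_mem).tendsto.comp hz
        rwa [c.map_one] at this
      have hI : Ioc t (min u 1) ∈ 𝓝[>] t := Ioc_mem_nhdsGT (lt_min hu ht.2)
      obtain ⟨τ, hτ, hzr, hgz, hd⟩ := ((eventually_mem_set.2 hI).and
        ((hz.eventually_mem (nbhd_mem_nhds (c := c) hr)).and
          ((hzc.eventually (hg1.eventually_mem (nbhd_mem_nhds (c := c) hr))).and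
            (hzc.eventually hder)))).exists
      have hτ1 : τ ≤ 1 := hτ.2.trans (min_le_right _ _)
      have hτ' : τ ∈ Icc (0 : ℝ) 1 := ⟨ht.1.trans hτ.1.le, hτ1⟩
      set z := (y t)⁻¹ * y τ with hz'
      rw [c.chart.left_inv hzr.1] at hgz
      have hd0 : c.chart (g * c.chart.symm 0 * g⁻¹) = 0 := by simp [symm_zero, c.map_one]
      simp only [c.chart.left_inv hzr.1, hd0, sub_zero] at hd
      have hyt := symm_mem (htr t ht')
      have e1 := c.norm_mul (y t) hyt.1 z hzr.1 (hyt.2.trans (htr t ht')) hzr.2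
      rw [hz', mul_inv_cancel_left, ← hz', apply_symm (htr t ht'), apply_symm (htr τ hτ'),
        hnorm t ht'] at e1
      have hfτ : f τ = f t * (g * z * g⁻¹) := by simp [hf, hz', mul_assoc]
      have e3 := c.norm_mul (f t) hfr.1 _ hgz.1 hfr.2 hgz.2
      have hfs := c.mul_mem (f t) hfr.1 _ hgz.1 hfr.2 hgz.2
      rw [← hfτ] at e3 hfs
      set ζ := c.chart z
      set p := c.chart (g * z * g⁻¹)
      have hM1 : c.M * (t * ‖v‖) ≤ 1 / 8 := by
        nlinarith [mul_le_mul_of_nonneg_left ht'.2 (mul_nonneg hM hv0.le)]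
      have hh : 0 < τ - t := sub_pos.2 hτ.1
      have n1 : ‖τ • v - t • v‖ = (τ - t) * ‖v‖ := by
        rw [← sub_smul, norm_smul, Real.norm_of_nonneg hh.le]
      have n2 : ‖ζ‖ ≤ 2 * ((τ - t) * ‖v‖) := by
        have := norm_sub_norm_le ζ (τ • v - t • v)
        rw [norm_sub_rev ζ, n1] at this
        nlinarith [mul_le_mul_of_nonneg_right hM1 (norm_nonneg ζ), norm_nonneg ζ]
      have n3 : ‖c.ad g (ζ - (τ • v - t • v))‖ ≤ C * (c.M * ‖v‖ * (2 * ((τ - t) * ‖v‖))) := by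
        refine ((c.ad g).le_of_opNorm_le hg _).trans (mul_le_mul_of_nonneg_left ?_ hC)
        rw [norm_sub_rev]
        refine e1.trans (mul_le_mul (mul_le_mul_of_nonneg_left ?_ hM) n2 (norm_nonneg _)
          (by positivity))
        nlinarith [ht'.2]
      have n4 : ‖p - c.ad g ζ‖ ≤ ‖v‖ * (2 * ((τ - t) * ‖v‖)) :=
        hd.trans (mul_le_mul_of_nonneg_left n2 hv0.le)
      have hA2 : 2 ≤ A := by
        have : 0 ≤ 2 * C * c.M + 2 * c.M * (C + 1) ^ 2 := by positivity
        linarith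
      have hv1 : ‖v‖ ≤ 1 := by nlinarith
      have n5 : ‖p‖ ≤ (C + 1) * (2 * ((τ - t) * ‖v‖)) := by
        have h1 := norm_le_norm_add_norm_sub' p (c.ad g ζ)
        have h2 := ((c.ad g).le_of_opNorm_le hg ζ).trans (mul_le_mul_of_nonneg_left n2 hC)
        nlinarith [mul_le_mul_of_nonneg_right hv1 (show 0 ≤ 2 * ((τ - t) * ‖v‖) by positivity)]
      have n6 : ∀ σ ∈ Icc (0 : ℝ) 1, ∀ w : E, ‖w - σ • c.ad g v‖ ≤ A * σ * ‖v‖ ^ 2 →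
          ‖w‖ ≤ (C + 1) * ‖v‖ := fun σ hσ w hw => by
        have h1 := norm_le_norm_add_norm_sub' w (σ • c.ad g v)
        rw [norm_smul, Real.norm_of_nonneg hσ.1] at h1
        have h2 : σ * ‖c.ad g v‖ ≤ C * ‖v‖ :=
          (mul_le_of_le_one_left (norm_nonneg _) hσ.2).trans hAdv
        have h3 : A * σ * ‖v‖ ^ 2 ≤ ‖v‖ := by
          calc A * σ * ‖v‖ ^ 2 = σ * ((A * ‖v‖) * ‖v‖) := by ring
            _ ≤ 1 * (1 * ‖v‖) := by gcongr; exact hσ.2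
            _ = ‖v‖ := by ring
        linarith
      have n7 : ‖c.chart (f τ) - c.chart (f t) - p‖ ≤
          c.M * ((C + 1) * ‖v‖) * ((C + 1) * (2 * ((τ - t) * ‖v‖))) :=
        e3.trans (mul_le_mul (mul_le_mul_of_nonneg_left (n6 t ht' _ hft) hM) n5 (norm_nonneg _)
          (by positivity))
      have n8 : ‖c.chart (f τ) - τ • c.ad g v‖ ≤ A * τ * ‖v‖ ^ 2 := by
        have : c.chart (f τ) - τ • c.ad g v = (c.chart (f τ) - c.chart (f t) - p) +
            ((c.chart (f t) - t • c.ad g v) +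
              ((p - c.ad g ζ) + c.ad g (ζ - (τ • v - t • v)))) := by
          simp only [map_sub, map_smul]; abel
        rw [this]
        refine (norm_add_le_of_le n7 (norm_add_le_of_le hft (norm_add_le_of_le n4 n3))).trans ?_
        rw [hA]
        apply le_of_eq
        ring
      exact ⟨τ, ⟨⟨hfs, (n6 τ hτ' _ n8).trans hCr⟩, n8⟩, hτ.1, hτ.2.trans (min_le_left _ _)⟩
  have := key (right_mem_Icc.2 zero_le_one)
  simp only [hs, hf, hy, mem_ofPred_eq, one_smul, hxv, mul_one] at this
  exact ⟨this.1.1, this.2⟩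

end QuadraticChart

/-! ### Haar averaging -/

open MeasureTheory in
/-- Averaging over a compact group with respect to its Haar probability measure. -/
theorem exists_average_of_compact_group (K E : Type*) [Group K] [TopologicalSpace K]
    [IsTopologicalGroup K] [CompactSpace K] [NormedAddCommGroup E] [NormedSpace ℝ E]
    [CompleteSpace E] :
    ∃ A : C(K, E) →ₗ[ℝ] E, (∀ v : E, A (ContinuousMap.const K v) = v) ∧
      (∀ (f : C(K, E)) (C : ℝ), (∀ x, ‖f x‖ ≤ C) → ‖A f‖ ≤ C) ∧
      (∀ (f : C(K, E)) (g : K), A (f.comp ⟨fun x => g * x, continuous_const_mul g⟩) = A f) ∧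
      (∀ (f : C(K, E)) (L : E →L[ℝ] E), A ((L : C(E, E)).comp f) = L (A f)) ∧
      ∀ f : C(K × K, E), Continuous fun s => A (f.curry s) := by
  let _ : MeasurableSpace K := borel K
  have : BorelSpace K := ⟨rfl⟩
  set μ := Measure.haarMeasure (⊤ : TopologicalSpace.PositiveCompacts K)
  have : IsProbabilityMeasure μ := ⟨by
    have := Measure.haarMeasure_self (K₀ := (⊤ : TopologicalSpace.PositiveCompacts K))
    simpa using this⟩
  have hint : ∀ f : C(K, E), Integrable f μ := fun f =>
    f.continuous.integrable_of_hasCompactSupport (HasCompactSupport.of_compactSpace f)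
  refine ⟨⟨⟨fun f => ∫ x, f x ∂μ, fun f g => integral_add (hint f) (hint g)⟩,
    fun a f => integral_smul a f⟩, fun v => ?_, fun f C h => ?_, fun f g => ?_, fun f L => ?_,
    fun f => ?_⟩
  · simp
  · simpa using norm_integral_le_of_norm_le_const (μ := μ) (Eventually.of_forall h)
  · exact integral_mul_left_eq_self (μ := μ) (fun x => f x) g
  · exact L.integral_comp_comm (hint f)
  · rw [← continuousOn_univ]
    exact continuousOn_integral_of_compact_support (k := univ) isCompact_univ
      (f.continuous.continuousOn) (fun _ x _ hx => (hx (mem_univ x)).elim)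

/-! ### One Newton step -/

namespace QuadraticChart

variable {U E : Type*} [TopologicalSpace U] [Group U] [NormedAddCommGroup E] [NormedSpace ℝ E]
  {c : QuadraticChart U E}

/-- Together with `inv_near`, this linearises words in the group factor by factor, tracking both the
radius and the first-order error. -/
theorem mul_near {x y : U} {v w : E} {e f η : ℝ} (hη : η ≤ c.r) (hx : x ∈ c.nbhd η)
    (hy : y ∈ c.nbhd η) (hxv : ‖c.chart x - v‖ ≤ e) (hyw : ‖c.chart y - w‖ ≤ f) :
    x * y ∈ c.nbhd (3 * η) ∧ ‖c.chart (x * y) - (v + w)‖ ≤ e + f + c.M * η ^ 2 := by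
  have h0 : 0 ≤ η := (norm_nonneg _).trans hx.2
  have h1 := c.norm_mul x hx.1 y hy.1 (hx.2.trans hη) (hy.2.trans hη)
  have h2 : ‖c.chart (x * y) - c.chart x - c.chart y‖ ≤ c.M * η ^ 2 := by
    refine h1.trans ?_
    rw [pow_two, ← mul_assoc]
    exact mul_le_mul (mul_le_mul_of_nonneg_left hx.2 c.M_nonneg) hy.2 (norm_nonneg _)
      (mul_nonneg c.M_nonneg h0)
  have h3 : c.M * η ^ 2 ≤ η := by
    have := (mul_le_mul_of_nonneg_left hη c.M_nonneg).trans c.M_mul_r_le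
    nlinarith
  refine ⟨⟨c.mul_mem x hx.1 y hy.1 (hx.2.trans hη) (hy.2.trans hη), ?_⟩, ?_⟩
  · have : c.chart (x * y) = (c.chart (x * y) - c.chart x - c.chart y) + (c.chart x + c.chart y) := by
      abel
    rw [this]
    refine (norm_add_le_of_le h2 (norm_add_le_of_le hx.2 hy.2)).trans ?_
    linarith
  · have : c.chart (x * y) - (v + w) = (c.chart x - v) + (c.chart y - w) +
        (c.chart (x * y) - c.chart x - c.chart y) := by abel
    rw [this]
    exact norm_add_le_of_le (norm_add_le_of_le hxv hyw) h2

theorem inv_near {x : U} {v : E} {e η : ℝ} (hη : η ≤ c.r) (hx : x ∈ c.nbhd η)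
    (hxv : ‖c.chart x - v‖ ≤ e) :
    x⁻¹ ∈ c.nbhd (2 * η) ∧ ‖c.chart x⁻¹ - -v‖ ≤ e + c.M * η ^ 2 := by
  have h0 : 0 ≤ η := (norm_nonneg _).trans hx.2
  have h2 : ‖c.chart x⁻¹ + c.chart x‖ ≤ c.M * η ^ 2 :=
    (c.norm_inv x hx.1 (hx.2.trans hη)).trans
      (mul_le_mul_of_nonneg_left (pow_le_pow_left₀ (norm_nonneg _) hx.2 2) c.M_nonneg)
  have h3 : c.M * η ^ 2 ≤ η := by
    have := (mul_le_mul_of_nonneg_left hη c.M_nonneg).trans c.M_mul_r_le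
    nlinarith
  refine ⟨⟨c.inv_mem x hx.1 (hx.2.trans hη), ?_⟩, ?_⟩
  · have : c.chart x⁻¹ = (c.chart x⁻¹ + c.chart x) - c.chart x := by abel
    rw [this]
    exact (norm_sub_le_of_le h2 hx.2).trans (by linarith)
  · have : c.chart x⁻¹ - -v = (c.chart x⁻¹ + c.chart x) - (c.chart x - v) := by abel
    rw [this]
    exact (norm_sub_le_of_le h2 hxv).trans (by linarith)

variable [IsTopologicalGroup U] [CompleteSpace E]

/-- The failure of `φ` to be multiplicative. -/
def defect {K : Type*} [Group K] (φ : K → U) (s t : K) : U := φ s * φ t * (φ (s * t))⁻¹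

/-- Averaging the defect of an almost morphism yields a correction which makes the defect
quadratically smaller. -/
theorem exists_correction (c : QuadraticChart U E) {C : ℝ} (hC : 0 ≤ C) :
    ∃ ε₀ B : ℝ, 0 < ε₀ ∧ ε₀ ≤ c.r ∧ 0 ≤ B ∧ ∀ (K : Type*) [Group K] [TopologicalSpace K]
      [IsTopologicalGroup K] [CompactSpace K] (φ : K → U) (ε : ℝ), Continuous φ →
      (∀ s, ‖c.ad (φ s)‖ ≤ C) → ε ≤ ε₀ → (∀ s t, defect φ s t ∈ c.nbhd ε) →
      ∃ β : K → U, Continuous β ∧ (∀ s, β s ∈ c.nbhd ε) ∧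
        ∀ s t, defect (fun s => (β s)⁻¹ * φ s) s t ∈ c.nbhd (B * ε ^ 2) := by
  obtain ⟨ρ, A, hρ, hρr, hA, hconj⟩ := c.exists_norm_conj_sub_le hC
  have hM := c.M_nonneg
  have hr := c.r_pos
  -- Conjugation by φ(s) maps radius ε into radius Lε: C comes from Ad, Aρ absorbs the quadratic
  -- term, and 1 ensures ε ≤ Lε.
  set L := C + A * ρ + 1 with hL
  have hL1 : 1 ≤ L := by rw [hL]; nlinarith
  have hL0 : 0 < L := by linarith
  -- Radius 6η is the largest needed below. Of the 45, the linearised word costs 1 + 1 + 4 + 1 + 36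
  -- and the averaged cocycle relation 2; each of the two also costs one A.
  refine ⟨min ρ (c.r / (6 * L)), (2 * A + 45 * c.M) * L ^ 2, by positivity,
    (min_le_left _ _).trans hρr, by positivity, ?_⟩
  intro K _ _ _ _ φ ε hφ had hε hα
  have hε0 : 0 ≤ ε := (norm_nonneg _).trans (hα 1 1).2
  have hερ : ε ≤ ρ := hε.trans (min_le_left _ _)
  set η := L * ε with hη
  have hηr : 6 * η ≤ c.r := by
    have := hε.trans (min_le_right _ _)
    rw [le_div_iff₀ (by positivity)] at this
    rw [hη]; linarith
  have hη0 : 0 ≤ η := by positivity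
  have hεη : ε ≤ η := le_mul_of_one_le_left hε0 hL1
  have hεη2 : ε ^ 2 ≤ η ^ 2 := pow_le_pow_left₀ hε0 hεη 2
  have hηr' : η ≤ c.r := by linarith
  have hconj' : ∀ s, ∀ x ∈ c.nbhd ε, φ s * x * (φ s)⁻¹ ∈ c.nbhd η ∧
      ‖c.chart (φ s * x * (φ s)⁻¹) - c.ad (φ s) (c.chart x)‖ ≤ A * η ^ 2 := by
    intro s x hx
    obtain ⟨h1, h2⟩ := hconj (φ s) (had s) x (nbhd_mono hερ hx)
    have h3 := (c.ad (φ s)).le_of_opNorm_le (had s) (c.chart x)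
    refine ⟨⟨h1, ?_⟩, h2.trans (mul_le_mul_of_nonneg_left
      (pow_le_pow_left₀ (norm_nonneg _) (hx.2.trans hεη) 2) hA)⟩
    have h4 := norm_le_norm_add_norm_sub' (c.chart (φ s * x * (φ s)⁻¹)) (c.ad (φ s) (c.chart x))
    have h5 : C * ‖c.chart x‖ ≤ C * ε := mul_le_mul_of_nonneg_left hx.2 hC
    have h6 : A * ‖c.chart x‖ ^ 2 ≤ A * (ρ * ε) := by
      refine mul_le_mul_of_nonneg_left ?_ hA
      rw [pow_two]
      exact mul_le_mul (hx.2.trans hερ) hx.2 (norm_nonneg _) hρ.le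
    rw [hη, hL]
    linarith
  have hαc : Continuous fun p : K × K => defect φ p.1 p.2 := by
    unfold defect; fun_prop
  let a : C(K × K, E) := ⟨fun p => c.chart (defect φ p.1 p.2),
    c.chart.continuousOn.comp_continuous hαc fun p => (hα p.1 p.2).1⟩
  -- Linearisation of the exact nonabelian cocycle identity `e`, which is associativity of
  -- φ(r)φ(s)φ(t).
  have hcoc : ∀ r s t, ‖a (r, s) + a (r * s, t) - c.ad (φ r) (a (s, t)) - a (r, s * t)‖ ≤
      (A + 2 * c.M) * η ^ 2 := by
    intro r s t
    have h1 := hconj' r _ (hα s t)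
    have e : defect φ r s * defect φ (r * s) t =
        (φ r * defect φ s t * (φ r)⁻¹) * defect φ r (s * t) := by
      simp [defect, mul_assoc]
    have hs := fun s t => nbhd_mono hεη (hα s t)
    have h2 := (mul_near hηr' (hs r s) (hs (r * s) t) (v := a (r, s)) (w := a (r * s, t))
      (e := 0) (f := 0) (by simp [a]) (by simp [a])).2
    have h3 := (mul_near hηr' h1.1 (hs r (s * t)) (w := a (r, s * t))
      (f := 0) h1.2 (by simp [a])).2
    rw [← e] at h3
    have := norm_sub_le_of_le h3 h2
    refine le_trans (le_of_eq ?_) (this.trans (le_of_eq (by ring)))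
    congr 1
    simp only [a, ContinuousMap.coe_mk]
    abel
  obtain ⟨I, I_const, I_norm, I_mul, I_clm, I_cont⟩ := exists_average_of_compact_group K E
  let b : K → E := fun s => I (a.curry s)
  have hb : ∀ s, ‖b s‖ ≤ ε := fun s => I_norm _ _ fun t => (hα s t).2
  have hbr : ∀ s, ‖b s‖ ≤ c.r := fun s => (hb s).trans (hεη.trans hηr')
  have hbc : Continuous b := I_cont a
  -- Average over t: left invariance turns the mean of a(r, st) into b(r).
  have hcob : ∀ r s, ‖a (r, s) + b (r * s) - c.ad (φ r) (b s) - b r‖ ≤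
      (A + 2 * c.M) * η ^ 2 := by
    intro r s
    have := I_norm (ContinuousMap.const K (a (r, s)) + a.curry (r * s) -
      (c.ad (φ r) : C(E, E)).comp (a.curry s) -
      (a.curry r).comp ⟨fun x => s * x, continuous_const_mul s⟩) _ (fun t => hcoc r s t)
    rwa [map_sub, map_sub, map_add, I_const, I_clm, I_mul] at this
  refine ⟨fun s => c.chart.symm (b s), ?_, fun s => nbhd_mono (hb s) (symm_mem (hbr s)), ?_⟩
  · exact c.chart.continuousOn_symm.comp_continuous hbc fun s => mem_target (hbr s)
  intro r s
  set β : K → U := fun s => c.chart.symm (b s) with hβ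
  have hβ1 : ∀ s, β s ∈ c.nbhd ε := fun s => nbhd_mono (hb s) (symm_mem (hbr s))
  have hβ2 : ∀ s, c.chart (β s) = b s := fun s => apply_symm (hbr s)
  -- The first-order part of the right side is exactly the expression bounded in `hcob`.
  have e : defect (fun s => (β s)⁻¹ * φ s) r s = ((β r)⁻¹ * (φ r * β s * (φ r)⁻¹)⁻¹) *
      (defect φ r s * β (r * s)) := by
    simp [defect, mul_assoc]
  have k1 := inv_near hηr' (nbhd_mono hεη (hβ1 r)) (v := b r) (e := 0) (by simp [hβ2])
  have k2 := hconj' r _ (hβ1 s)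
  rw [hβ2] at k2
  have k3 := inv_near hηr' k2.1 k2.2
  have k4 := mul_near (by linarith) k1.1 k3.1 k1.2 k3.2
  have k5 := mul_near hηr' (nbhd_mono hεη (hα r s)) (nbhd_mono hεη (hβ1 (r * s)))
    (v := a (r, s)) (w := b (r * s)) (e := 0) (f := 0) (by simp [a]) (by simp [hβ2])
  have k6 := mul_near (by linarith) k4.1 (nbhd_mono (by linarith) k5.1) k4.2 k5.2
  rw [← e] at k6
  refine ⟨c.mul_mem _ k4.1.1 _ k5.1.1 (k4.1.2.trans (by linarith))
    (k5.1.2.trans (by linarith)) |> fun h => e ▸ h, ?_⟩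
  have h := norm_add_le_of_le k6.2 (hcob r s)
  have h1 : c.chart (defect (fun s => (β s)⁻¹ * φ s) r s) =
      c.chart (defect (fun s => (β s)⁻¹ * φ s) r s) -
        (-b r + -c.ad (φ r) (b s) + (a (r, s) + b (r * s))) +
      (a (r, s) + b (r * s) - c.ad (φ r) (b s) - b r) := by abel
  rw [h1]
  refine h.trans (le_trans (le_of_eq ?_) (?_ : (2 * A + 45 * c.M) * η ^ 2 ≤ _))
  · ring
  · rw [hη, mul_pow, ← mul_assoc]

end QuadraticChart

/-! ### Iteration and passage to the limit -/

namespace QuadraticChart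

variable {U E : Type*} [TopologicalSpace U] [Group U] [NormedAddCommGroup E] [NormedSpace ℝ E]
  {c : QuadraticChart U E} [IsTopologicalGroup U]

/-- Conjugations with bounded adjoint operators are equicontinuous at `1`. -/
theorem exists_conj_mem (c : QuadraticChart U E) {C : ℝ} (hC : 0 ≤ C) {W : Set U}
    (hW : W ∈ 𝓝 (1 : U)) :
    ∃ V ∈ 𝓝 (1 : U), ∀ g, ‖c.ad g‖ ≤ C → ∀ x ∈ V, g * x * g⁻¹ ∈ W := by
  obtain ⟨ρ, A, hρ, hρr, hA, hconj⟩ := c.exists_norm_conj_sub_le hC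
  obtain ⟨σ, hσ, -, hσW⟩ := exists_nbhd_subset (c := c) hW
  refine ⟨c.nbhd (min ρ (σ / (C + A * ρ + 1))), nbhd_mem_nhds (by positivity), ?_⟩
  intro g hg x hx
  have h1 := hx.2.trans (min_le_left _ _)
  have h2 := hx.2.trans (min_le_right _ _)
  rw [le_div_iff₀ (by positivity)] at h2
  obtain ⟨h3, h4⟩ := hconj g hg x ⟨hx.1, h1⟩
  refine hσW ⟨h3, ?_⟩
  have h5 := norm_le_norm_add_norm_sub' (c.chart (g * x * g⁻¹)) (c.ad g (c.chart x))
  have h6 := (c.ad g).le_of_opNorm_le hg (c.chart x)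
  have h7 : A * ‖c.chart x‖ ^ 2 ≤ A * ρ * ‖c.chart x‖ := by
    rw [pow_two, mul_assoc]
    gcongr
  linarith [norm_nonneg (c.chart x)]

variable [CompleteSpace E]

/-- The coordinates of w n are uniformly Cauchy, so completeness of E suffices and none is needed of
U. The defect of the limit is the limit of the defects, which is 1 since U is Hausdorff. -/
theorem exists_morphism_of_approximations [T2Space U] {K : Type*} [Group K] [TopologicalSpace K]
    {φ : K → U} (hφ : Continuous φ) {ε : ℝ} (hε : 4 * ε ≤ c.r) {w : ℕ → K → U}
    (hw : ∀ n, Continuous (w n)) (hw' : ∀ n s, w n s ∈ c.nbhd (4 * ε * (1 - (1 / 2) ^ n)))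
    (hd : ∀ n s, ‖c.chart (w n s) - c.chart (w (n + 1) s)‖ ≤ 4 * ε / 2 / 2 ^ n)
    (hα : ∀ n s t, defect (fun s => w n s * φ s) s t ∈ c.nbhd (ε / 2 ^ n)) :
    ∃ ψ : K →* U, Continuous ψ ∧ ∀ s, ψ s * (φ s)⁻¹ ∈ c.nbhd (4 * ε) := by
  have hε0 : 0 ≤ ε := by
    have := (norm_nonneg _).trans (hα 0 1 1).2
    simpa using this
  have hd' : ∀ s n, dist (c.chart (w n s)) (c.chart (w (n + 1) s)) ≤ 4 * ε / 2 / 2 ^ n :=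
    fun s n => by rw [dist_eq_norm]; exact hd n s
  choose u hu using fun s => cauchySeq_tendsto_of_complete (cauchySeq_of_le_geometric_two (hd' s))
  have hwr : ∀ n s, w n s ∈ c.nbhd (4 * ε) := fun n s => nbhd_mono
    (mul_le_of_le_one_right (by positivity) (sub_le_self _ (by positivity))) (hw' n s)
  have hur : ∀ s, ‖u s‖ ≤ 4 * ε := fun s =>
    le_of_tendsto (hu s).norm (Eventually.of_forall fun n => (hwr n s).2)
  have hur' := fun s => (hur s).trans hε
  have huc : Continuous u := by
    have hpow : Tendsto (fun n : ℕ => 4 * ε / 2 ^ n) atTop (𝓝 0) := by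
      have := (tendsto_pow_atTop_nhds_zero_of_lt_one (r := (1 / 2 : ℝ)) (by norm_num)
        (by norm_num)).const_mul (4 * ε)
      simpa [div_eq_mul_inv] using this
    have : TendstoUniformly (fun n s => c.chart (w n s)) u atTop := by
      rw [Metric.tendstoUniformly_iff]
      intro e he
      filter_upwards [hpow.eventually_lt_const he] with n hn s
      rw [dist_comm]
      exact (dist_le_of_le_geometric_two_of_tendsto (hd' s) (hu s) n).trans_lt hn
    exact this.continuous (Eventually.of_forall fun n =>
      c.chart.continuousOn.comp_continuous (hw n) fun s => (hwr n s).1).frequently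
  have hlim : ∀ s, Tendsto (fun n => w n s * φ s) atTop (𝓝 (c.chart.symm (u s) * φ s)) := by
    intro s
    refine Tendsto.mul_const _ ?_
    have := (continuousAt_symm (hur' s)).tendsto.comp (hu s)
    refine this.congr fun n => ?_
    exact c.chart.left_inv (hwr n s).1
  have hmul : ∀ s t, c.chart.symm (u (s * t)) * φ (s * t) =
      c.chart.symm (u s) * φ s * (c.chart.symm (u t) * φ t) := by
    intro s t
    have h1 := ((hlim s).mul (hlim t)).mul (hlim (s * t)).inv
    have h2 : Tendsto (fun n => defect (fun s => w n s * φ s) s t) atTop (𝓝 1) := by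
      rw [tendsto_def]
      intro W hW
      obtain ⟨ρ, hρ, -, hsub⟩ := exists_nbhd_subset (c := c) hW
      have hpow : Tendsto (fun n : ℕ => ε / 2 ^ n) atTop (𝓝 0) := by
        have := (tendsto_pow_atTop_nhds_zero_of_lt_one (r := (1 / 2 : ℝ)) (by norm_num)
          (by norm_num)).const_mul ε
        simpa [div_eq_mul_inv] using this
      filter_upwards [hpow.eventually_lt_const hρ] with n hn
      exact hsub (nbhd_mono hn.le (hα n s t))
    exact (mul_inv_eq_one.1 (tendsto_nhds_unique h1 h2)).symm
  refine ⟨MonoidHom.mk' (fun s => c.chart.symm (u s) * φ s) hmul, ?_, fun s => ?_⟩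
  · exact (c.chart.continuousOn_symm.comp_continuous huc fun s => mem_target (hur' s)).mul hφ
  · simpa using nbhd_mono (hur s) (symm_mem (hur' s))

/-- A continuous map from a compact group, with bounded adjoint operators and small defect, is
close to a continuous morphism. -/
theorem exists_morphism_near [T2Space U] (c : QuadraticChart U E) {C : ℝ} (hC : 0 ≤ C) {W : Set U}
    (hW : W ∈ 𝓝 (1 : U)) :
    ∃ V ∈ 𝓝 (1 : U), ∀ (K : Type*) [Group K] [TopologicalSpace K]
      [IsTopologicalGroup K] [CompactSpace K] (φ : K → U), Continuous φ →
      (∀ s, ‖c.ad (φ s)‖ ≤ C) → (∀ s t, defect φ s t ∈ V) →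
      ∃ ψ : K →* U, Continuous ψ ∧ ∀ s, ψ s * (φ s)⁻¹ ∈ W := by
  -- Doubling C covers every later iterate w·φ with w in `c.nbhd c.r`, so the same B serves at each
  -- stage.
  obtain ⟨ε₀, B, hε₀, hε₀r, hB, hstep⟩ := c.exists_correction (C := 2 * C) (by positivity)
  obtain ⟨ρ, hρ, hρr, hρW⟩ := exists_nbhd_subset (c := c) hW
  have hr := c.r_pos
  -- Bε ≤ 1/2 turns quadratic decay into halving; ρ/4 accommodates the total displacement 4ε.
  set ε := min ε₀ (min (1 / (2 * (B + 1))) (ρ / 4)) with hεdef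
  have hε : 0 < ε := by positivity
  have h1 : ε ≤ ε₀ := min_le_left _ _
  have h2 : B * ε ≤ 1 / 2 := by
    have : ε ≤ 1 / (2 * (B + 1)) := (min_le_right _ _).trans (min_le_left _ _)
    rw [le_div_iff₀ (by positivity)] at this
    linarith
  have h3 : 4 * ε ≤ ρ := by
    have : ε ≤ ρ / 4 := (min_le_right _ _).trans (min_le_right _ _)
    linarith
  refine ⟨c.nbhd ε, nbhd_mem_nhds hε, ?_⟩
  intro K _ _ _ _ φ hφ had hα
  -- The radius 4ε(1 − 2⁻ⁿ) is the sum of the first n step sizes 2ε/2ᵏ.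
  let P : ℕ → (K → U) → Prop := fun n w => Continuous w ∧
    (∀ s, w s ∈ c.nbhd (4 * ε * (1 - (1 / 2) ^ n))) ∧
    ∀ s t, defect (fun s => w s * φ s) s t ∈ c.nbhd (ε / 2 ^ n)
  have hP : ∀ n w, P n w → ∃ w', P (n + 1) w' ∧
      ∀ s, ‖c.chart (w s) - c.chart (w' s)‖ ≤ 4 * ε / 2 / 2 ^ n := by
    rintro n w ⟨hwc, hwn, hwα⟩
    set δ := ε / 2 ^ n with hδ
    have hδ0 : 0 < δ := by positivity
    have hδε : δ ≤ ε := div_le_self hε.le (one_le_pow₀ (by norm_num))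
    have hδr : δ ≤ c.r := hδε.trans (h1.trans hε₀r)
    have hwr : ∀ s, w s ∈ c.nbhd c.r := fun s => nbhd_mono
      ((mul_le_of_le_one_right (by positivity) (sub_le_self _ (by positivity))).trans
        (h3.trans hρr)) (hwn s)
    obtain ⟨β, hβc, hβ, hβα⟩ := hstep K (fun s => w s * φ s) δ (hwc.mul hφ)
      (fun s => norm_ad_mul_le (hwr s) (had s)) (hδε.trans h1) hwα
    have hβi := fun s => inv_near hδr (hβ s) (v := c.chart (β s)) (e := 0) (by simp)
    have hMδ : c.M * δ ≤ 1 / 8 :=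
      (mul_le_mul_of_nonneg_left hδr c.M_nonneg).trans c.M_mul_r_le
    have hβi' : ∀ s, ‖c.chart (β s)⁻¹‖ ≤ 9 / 8 * δ := fun s => by
      have h := norm_le_norm_add_norm_sub' (c.chart (β s)⁻¹) (-c.chart (β s))
      rw [norm_neg] at h
      nlinarith [(hβi s).2, (hβ s).2]
    have hMr := c.M_mul_r_le
    have hβir : ∀ s, ‖c.chart (β s)⁻¹‖ ≤ c.r := fun s => by
      have : 4 * δ ≤ c.r := by linarith
      linarith [hβi' s]
    have hdist : ∀ s, ‖c.chart (w s) - c.chart ((β s)⁻¹ * w s)‖ ≤ 4 * ε / 2 / 2 ^ n := by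
      intro s
      have h4 := c.norm_mul _ (hβi s).1.1 _ (hwr s).1 (hβir s) (hwr s).2
      have h5 : c.M * ‖c.chart (β s)⁻¹‖ * ‖c.chart (w s)‖ ≤ 1 / 8 * ‖c.chart (β s)⁻¹‖ := by
        have := mul_le_mul_of_nonneg_right ((mul_le_mul_of_nonneg_left (hwr s).2
          c.M_nonneg).trans hMr) (norm_nonneg (c.chart (β s)⁻¹))
        linarith
      have e : c.chart (w s) - c.chart ((β s)⁻¹ * w s) = -(c.chart ((β s)⁻¹ * w s) -
        c.chart (β s)⁻¹ - c.chart (w s)) - c.chart (β s)⁻¹ := by abel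
      rw [e]
      have h6 := norm_sub_le_of_le ((norm_neg _).le.trans (h4.trans h5)) (hβi' s)
      have h7 : 4 * ε / 2 / 2 ^ n = 2 * δ := by rw [hδ]; ring
      rw [h7]
      linarith [hβi' s]
    refine ⟨fun s => (β s)⁻¹ * w s, ⟨hβc.inv.mul hwc, fun s => ⟨?_, ?_⟩, fun s t => ?_⟩, hdist⟩
    · exact c.mul_mem _ (hβi s).1.1 _ (hwr s).1 (hβir s) (hwr s).2
    · have h4 := norm_le_norm_add_norm_sub (c.chart (w s)) (c.chart ((β s)⁻¹ * w s))
      refine (h4.trans (add_le_add (hwn s).2 (hdist s))).trans (le_of_eq ?_)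
      rw [pow_succ, one_div, inv_pow]
      field_simp
      ring
    · have h4 := hβα s t
      simp only [← mul_assoc] at h4
      refine nbhd_mono ?_ h4
      have h5 : B * δ ≤ 1 / 2 := (mul_le_mul_of_nonneg_left hδε hB).trans h2
      calc B * δ ^ 2 = B * δ * δ := by ring
        _ ≤ 1 / 2 * δ := by gcongr
        _ = ε / 2 ^ (n + 1) := by rw [hδ, pow_succ]; field_simp
  have hP0 : P 0 fun _ => 1 :=
    ⟨continuous_const, fun s => one_mem_nbhd (by simp), fun s t => by simpa [defect] using hα s t⟩
  choose! F hF hFd using hP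
  let w : ℕ → K → U := fun n => Nat.rec (fun _ => 1) (fun n v => F n v) n
  have hw : ∀ n, P n (w n) := fun n => by
    induction n with
    | zero => exact hP0
    | succ n ih => exact hF n _ ih
  obtain ⟨ψ, hψ, hψ'⟩ := exists_morphism_of_approximations (c := c) hφ (h3.trans hρr)
    (fun n => (hw n).1) (fun n => (hw n).2.1) (fun n => hFd n _ (hw n)) (fun n => (hw n).2.2)
  exact ⟨ψ, hψ, fun s => hρW (nbhd_mono h3 (hψ' s))⟩

end QuadraticChart

/-! ### The quadratic chart of a Banach Lie group -/

/-- A `C²` local multiplication with unit `0` is addition up to a quadratic error. -/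
theorem ContDiffAt.exists_norm_sub_sub_le {E : Type*} [NormedAddCommGroup E] [NormedSpace ℝ E]
    {f : E × E → E} (hf : ContDiffAt ℝ 2 f 0) (h1 : ∀ᶠ u in 𝓝 (0 : E), f (u, 0) = u)
    (h2 : ∀ᶠ v in 𝓝 (0 : E), f (0, v) = v) :
    ∃ r M : ℝ, 0 < r ∧ 0 ≤ M ∧ ∀ u v : E, ‖u‖ ≤ r → ‖v‖ ≤ r →
      ‖f (u, v) - u - v‖ ≤ M * ‖u‖ * ‖v‖ := by
  obtain ⟨κ, t, ht, hlip⟩ := (hf.fderiv_right (m := 1) (by norm_num)).exists_lipschitzOnWith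
  have hdiff : ∀ᶠ p in 𝓝 (0 : E × E), DifferentiableAt ℝ f p :=
    (hf.eventually (by simp)).mono fun p hp => hp.differentiableAt (by simp)
  obtain ⟨r, hr, hb⟩ := Metric.mem_nhds_iff.1 (inter_mem ht hdiff)
  obtain ⟨r', hr', hb'⟩ := Metric.mem_nhds_iff.1 (inter_mem h1 h2)
  refine ⟨min r r' / 2, κ, by positivity, κ.2, fun u v hu hv => ?_⟩
  have hρ : min r r' / 2 < min r r' := half_lt_self (by positivity)
  have hball : ∀ u v : E, ‖u‖ ≤ min r r' / 2 → ‖v‖ ≤ min r r' / 2 →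
      (u, v) ∈ t ∩ {p | DifferentiableAt ℝ f p} := fun u v hu hv => hb (by
    rw [mem_ball_zero_iff, Prod.norm_def, max_lt_iff]
    exact ⟨(hu.trans_lt hρ).trans_le (min_le_left _ _), (hv.trans_lt hρ).trans_le (min_le_left _ _)⟩)
  have hu' := (hb' (show u ∈ ball 0 r' by
    rw [mem_ball_zero_iff]; exact (hu.trans_lt hρ).trans_le (min_le_right _ _))).1
  have hv' := (hb' (show v ∈ ball 0 r' by
    rw [mem_ball_zero_iff]; exact (hv.trans_lt hρ).trans_le (min_le_right _ _))).2
  have h0' := (hb' (mem_ball_self hr')).2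
  simp only [mem_ofPred_eq] at hu' hv' h0'
  have h00 : ‖(0 : E)‖ ≤ min r r' / 2 := by rw [norm_zero]; positivity
  -- Mean value inequality in v for f(u,v) − f(0,v): its derivative is at most κ‖u‖ because Df is
  -- κ-Lipschitz near 0.
  have key := (convex_closedBall (0 : E) (min r r' / 2)).norm_image_sub_le_of_norm_hasFDerivWithin_le
    (f := fun v => f (u, v) - f (0, v)) (C := κ * ‖u‖) (x := 0) (y := v)
    (f' := fun v => (fderiv ℝ f (u, v) - fderiv ℝ f (0, v)).comp (ContinuousLinearMap.inr ℝ E E))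
    (fun w hw => by
      have hw : ‖w‖ ≤ min r r' / 2 := by simpa using hw
      rw [ContinuousLinearMap.sub_comp]
      have d : ∀ u, HasFDerivAt (fun v : E => (u, v)) (ContinuousLinearMap.inr ℝ E E) w :=
        fun u => hasFDerivAt_prodMk_right u w
      exact (((hball u w hu hw).2.hasFDerivAt.comp w (d u)).sub
        ((hball 0 w h00 hw).2.hasFDerivAt.comp w (d 0))).hasFDerivWithinAt)
    (fun w hw => by
      have hw : ‖w‖ ≤ min r r' / 2 := by simpa using hw
      have h := hlip.norm_sub_le (hball u w hu hw).1 (hball 0 w h00 hw).1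
      have h' : ‖((u, w) : E × E) - (0, w)‖ = ‖u‖ := by simp [Prod.norm_def]
      rw [h'] at h
      exact (ContinuousLinearMap.opNorm_comp_le _ _).trans ((mul_le_of_le_one_right (norm_nonneg _)
        (ContinuousLinearMap.norm_inr_le_one ℝ E E)).trans h))
    (by simpa using h00) (by simpa using hv)
  simp only [hu', hv', h0', sub_zero] at key
  rwa [sub_right_comm] at key

section LieGroup

variable {𝕜 : Type*} [RCLike 𝕜] {E : Type*} [NormedAddCommGroup E] [NormedSpace 𝕜 E]
  {U : Type*} [TopologicalSpace U] [ChartedSpace E U] [Group U] [LieGroup 𝓘(𝕜, E) ω U]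

/-- The preferred chart at `1`, translated so that `1` has coordinate `0`. -/
noncomputable def chartAtOne (E : Type*) [NormedAddCommGroup E] (U : Type*) [TopologicalSpace U]
    [ChartedSpace E U] [Group U] : OpenPartialHomeomorph U E :=
  (chartAt E (1 : U)).transHomeomorph (Homeomorph.subRight (chartAt E (1 : U) 1))

theorem chartAtOne_apply (x : U) :
    chartAtOne E U x = chartAt E (1 : U) x - chartAt E (1 : U) 1 := rfl

theorem one_mem_chartAtOne_source : (1 : U) ∈ (chartAtOne E U).source := mem_chart_source E 1

theorem chartAtOne_one : chartAtOne E U 1 = 0 := by simp [chartAtOne_apply]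

theorem chartAtOne_symm_zero : (chartAtOne E U).symm 0 = 1 := by
  rw [← chartAtOne_one (U := U), (chartAtOne E U).left_inv one_mem_chartAtOne_source]

theorem contMDiffAt_chartAtOne : ContMDiffAt 𝓘(𝕜, E) 𝓘(𝕜, E) ω (chartAtOne E U) 1 := by
  have h : ContMDiffAt 𝓘(𝕜, E) 𝓘(𝕜, E) ω (chartAt E (1 : U)) 1 :=
    (contMDiffOn_chart (I := 𝓘(𝕜, E)) (n := ω) (x := (1 : U))).contMDiffAt
      ((chartAt E (1 : U)).open_source.mem_nhds (mem_chart_source E 1))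
  exact h.sub contMDiffAt_const

theorem contMDiffAt_chartAtOne_symm :
    ContMDiffAt 𝓘(𝕜, E) 𝓘(𝕜, E) ω (chartAtOne E U).symm 0 := by
  have h : ContMDiffAt 𝓘(𝕜, E) 𝓘(𝕜, E) ω (chartAt E (1 : U)).symm
      ((fun v : E => v + chartAt E (1 : U) 1) 0) :=
    (contMDiffOn_chart_symm (I := 𝓘(𝕜, E)) (n := ω) (x := (1 : U))).contMDiffAt
      ((chartAt E (1 : U)).open_target.mem_nhds (by simp))
  exact h.comp (f := fun v : E => v + chartAt E (1 : U) 1) (0 : E)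
    (contMDiffAt_id.add contMDiffAt_const)

theorem contDiffAt_mul_chartAtOne :
    ContDiffAt 𝕜 ω (fun p : E × E =>
      chartAtOne E U ((chartAtOne E U).symm p.1 * (chartAtOne E U).symm p.2)) 0 := by
  rw [← contMDiffAt_iff_contDiffAt]
  have h1 : ContMDiffAt 𝓘(𝕜, E × E) 𝓘(𝕜, E) ω (fun p : E × E => (chartAtOne E U).symm p.1) 0 :=
    (contMDiffAt_chartAtOne_symm (𝕜 := 𝕜) (E := E) (U := U)).comp (0 : E × E)
      (contMDiffAt_iff_contDiffAt.2 contDiffAt_fst)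
  have h2 : ContMDiffAt 𝓘(𝕜, E × E) 𝓘(𝕜, E) ω (fun p : E × E => (chartAtOne E U).symm p.2) 0 :=
    (contMDiffAt_chartAtOne_symm (𝕜 := 𝕜) (E := E) (U := U)).comp (0 : E × E)
      (contMDiffAt_iff_contDiffAt.2 contDiffAt_snd)
  have h3 := h1.mul h2
  have h4 : ContMDiffAt 𝓘(𝕜, E) 𝓘(𝕜, E) ω (chartAtOne E U)
      (((fun p : E × E => (chartAtOne E U).symm p.1) *
        fun p : E × E => (chartAtOne E U).symm p.2) 0) := by
    simpa [chartAtOne_symm_zero] using contMDiffAt_chartAtOne (𝕜 := 𝕜) (E := E) (U := U)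
  exact h4.comp (0 : E × E) h3

/-- Conjugation fixes 1, so the preferred charts at source and target coincide, and translating the
chart does not change the derivative. -/
theorem hasFDerivAt_conj_chartAtOne (g : U) :
    HasFDerivAt (fun v => chartAtOne E U (g * (chartAtOne E U).symm v * g⁻¹))
      (lieAd 𝕜 (E := E) g) 0 := by
  have hs : ContMDiff 𝓘(𝕜, E) 𝓘(𝕜, E) ω fun x : U => g * x * g⁻¹ :=
    (contMDiff_const.mul contMDiff_id).mul contMDiff_const
  have h1 := ((hs 1).mdifferentiableAt (by simp)).hasMFDerivAt.2
  simp only [writtenInExtChartAt, mfld_simps, extChartAt] at h1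
  have hg : g * 1 * g⁻¹ = (1 : U) := by simp
  rw [hg] at h1
  have h1' : HasFDerivAt (chartAt E (1 : U) ∘ (fun x => g * x * g⁻¹) ∘ (chartAt E (1 : U)).symm)
      (lieAd 𝕜 (E := E) g) (chartAt E (1 : U) 1) := hasFDerivWithinAt_univ.1 h1
  have h2 : HasFDerivAt (fun v : E => v + chartAt E (1 : U) 1) (ContinuousLinearMap.id 𝕜 E) 0 :=
    (hasFDerivAt_id 0).add_const _
  have h3 := (HasFDerivAt.comp (0 : E) (f := fun v : E => v + chartAt E (1 : U) 1)
    (by simpa using h1') h2).sub_const (chartAt E (1 : U) 1)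
  exact h3

end LieGroup

/-- The preferred chart at `1` of a Banach Lie group is a quadratic chart. -/
theorem exists_quadraticChart {𝕜 : Type*} [RCLike 𝕜] {E : Type*} [NormedAddCommGroup E]
    [NormedSpace 𝕜 E] [NormedSpace ℝ E] [IsScalarTower ℝ 𝕜 E] {U : Type*} [TopologicalSpace U]
    [RegularSpace U] [ChartedSpace E U] [Group U] [LieGroup 𝓘(𝕜, E) ω U] :
    ∃ c : QuadraticChart U E, ∀ g, c.ad g = (lieAd 𝕜 (E := E) g).restrictScalars ℝ := by
  have : IsTopologicalGroup U := topologicalGroup_of_lieGroup 𝓘(𝕜, E) ω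
  set κ := chartAtOne E U
  have h1s : (1 : U) ∈ κ.source := one_mem_chartAtOne_source
  have hκ1 : κ 1 = 0 := chartAtOne_one
  have hκ0 : κ.symm 0 = 1 := chartAtOne_symm_zero
  have h0t : (0 : E) ∈ κ.target := hκ1 ▸ κ.map_source h1s
  have hcs : Tendsto κ.symm (𝓝 0) (𝓝 1) := hκ0 ▸ κ.continuousAt_symm h0t
  have hc1 : Tendsto κ (𝓝 1) (𝓝 0) := hκ1 ▸ κ.continuousAt h1s
  have hs1 := κ.open_source.mem_nhds h1s
  have ht0 := κ.open_target.mem_nhds h0t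
  obtain ⟨r₀, M, hr₀, hM, hmul⟩ := ContDiffAt.exists_norm_sub_sub_le
    (((contDiffAt_mul_chartAtOne (𝕜 := 𝕜) (E := E) (U := U)).restrict_scalars ℝ).of_le le_top)
    (by filter_upwards [ht0] with u hu
        rw [chartAtOne_symm_zero, mul_one]; exact κ.right_inv hu)
    (by filter_upwards [ht0] with u hu
        rw [chartAtOne_symm_zero, one_mul]; exact κ.right_inv hu)
  -- Regularity gives a closed neighbourhood inside the chart domain, so small coordinate balls are
  -- closed in U and not only in the domain.
  obtain ⟨s, hs, hsc, hss⟩ := exists_mem_nhds_isClosed_subset hs1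
  have hinv : Tendsto (fun v => (κ.symm v)⁻¹) (𝓝 0) (𝓝 1) := by simpa using hcs.inv
  have hprod : Tendsto (fun p : E × E => κ.symm p.1 * κ.symm p.2) (𝓝 0) (𝓝 1) := by
    have := (hcs.comp (continuous_fst.tendsto (0 : E × E))).mul
      (hcs.comp (continuous_snd.tendsto (0 : E × E)))
    simpa using this
  have hsmall : 0 < min r₀ (1 / (2 * (M + 1))) := by positivity
  have hun : ∀ᶠ v in 𝓝 (0 : E), v ∈ κ.target ∧ κ.symm v ∈ s ∧ (κ.symm v)⁻¹ ∈ κ.source ∧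
      ‖κ (κ.symm v)⁻¹‖ ≤ min r₀ (1 / (2 * (M + 1))) := by
    filter_upwards [ht0, hcs hs, hinv hs1,
      (hc1.comp hinv) (closedBall_mem_nhds 0 hsmall)] with v h1 h2 h3 h4
    exact ⟨h1, h2, h3, by simpa using h4⟩
  obtain ⟨r₁, hr₁, h₁⟩ := Metric.nhds_basis_closedBall.eventually_iff.1 hun
  obtain ⟨r₂, hr₂, h₂⟩ := Metric.nhds_basis_closedBall.mem_iff.1 (hprod hs1)
  set r := min (min r₁ r₂) (min r₀ (1 / (16 * (M + 1)))) with hr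
  have hrr₁ : r ≤ r₁ := (min_le_left _ _).trans (min_le_left _ _)
  have hrr₂ : r ≤ r₂ := (min_le_left _ _).trans (min_le_right _ _)
  have hrr₀ : r ≤ r₀ := (min_le_right _ _).trans (min_le_left _ _)
  have hrM : r * (16 * (M + 1)) ≤ 1 := by
    rw [← le_div_iff₀ (by positivity)]
    exact (min_le_right _ _).trans (min_le_right _ _)
  have hr0 : 0 < r := by positivity
  have hun' : ∀ x ∈ κ.source, ‖κ x‖ ≤ r → x ∈ s ∧ x⁻¹ ∈ κ.source ∧
      ‖κ x⁻¹‖ ≤ min r₀ (1 / (2 * (M + 1))) := fun x hx hxr => by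
    have := (h₁ (show κ x ∈ closedBall 0 r₁ by simpa using hxr.trans hrr₁)).2
    rwa [κ.left_inv hx] at this
  have hmul' : ∀ x ∈ κ.source, ∀ y ∈ κ.source, ‖κ x‖ ≤ r₀ → ‖κ y‖ ≤ r₀ →
      ‖κ (x * y) - κ x - κ y‖ ≤ M * ‖κ x‖ * ‖κ y‖ := fun x hx y hy hxr hyr => by
    have := hmul _ _ hxr hyr
    change ‖κ (κ.symm (κ x) * κ.symm (κ y)) - _ - _‖ ≤ _ at this
    rwa [κ.left_inv hx, κ.left_inv hy] at this
  refine ⟨{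
    chart := κ
    ad := fun g => (lieAd 𝕜 (E := E) g).restrictScalars ℝ
    r := r
    -- The factor 2 is for inversion: expanding xx⁻¹ = 1 gives the error M‖x‖‖x⁻¹‖, and ‖x⁻¹‖ ≤ 2‖x‖
    -- in coordinates.
    M := 2 * M
    r_pos := hr0
    M_nonneg := by positivity
    M_mul_r_le := by nlinarith
    one_mem := h1s
    map_one := hκ1
    closedBall_subset := fun v hv => (h₁ (closedBall_subset_closedBall hrr₁ hv)).1
    isClosed_setOf := fun ρ hρ => ?_
    mul_mem := fun x hx y hy hxr hyr => ?_
    norm_mul := fun x hx y hy hxr hyr => ?_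
    inv_mem := fun x hx hxr => (hun' x hx hxr).2.1
    norm_inv := fun x hx hxr => ?_
    hasFDerivAt_conj := fun g => (hasFDerivAt_conj_chartAtOne (𝕜 := 𝕜) g).restrictScalars ℝ },
    fun g => rfl⟩
  · have h := (κ.continuousOn.mono hss).norm.preimage_isClosed_of_isClosed hsc
      (isClosed_Iic (a := ρ))
    convert h using 1
    ext x
    exact ⟨fun hx => ⟨(hun' x hx.1 (hx.2.trans hρ)).1, hx.2⟩, fun hx => ⟨hss hx.1, hx.2⟩⟩
  · have := h₂ (show (κ x, κ y) ∈ closedBall 0 r₂ by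
      rw [mem_closedBall_zero_iff, Prod.norm_def]
      exact max_le (hxr.trans hrr₂) (hyr.trans hrr₂))
    rwa [mem_preimage, κ.left_inv hx, κ.left_inv hy] at this
  · refine (hmul' x hx y hy (hxr.trans hrr₀) (hyr.trans hrr₀)).trans ?_
    gcongr
    linarith
  · obtain ⟨-, h2, h3⟩ := hun' x hx hxr
    have h4 := hmul' x hx _ h2 (hxr.trans hrr₀) (h3.trans (min_le_left _ _))
    rw [mul_inv_cancel, hκ1, zero_sub] at h4
    have h5 := h3.trans (min_le_right _ _)
    rw [le_div_iff₀ (by positivity)] at h5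
    have h6 : ‖κ x⁻¹ + κ x‖ ≤ M * ‖κ x‖ * ‖κ x⁻¹‖ := by
      have e : κ x⁻¹ + κ x = -(-κ x - κ x⁻¹) := by abel
      rwa [e, norm_neg]
    have h7 : ‖κ x⁻¹‖ ≤ 2 * ‖κ x‖ := by
      have h8 := norm_sub_norm_le (κ x⁻¹) (-κ x)
      rw [norm_neg, sub_neg_eq_add] at h8
      nlinarith [norm_nonneg (κ x), norm_nonneg (κ x⁻¹)]
    refine h6.trans ((mul_le_mul_of_nonneg_left h7 (by positivity)).trans (le_of_eq (by ring)))

/-! ### Invariant metrics and the conclusion -/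

theorem exists_pos_forall_dist_lt {U : Type*} [MetricSpace U] [Group U] {V : Set U}
    (hV : V ∈ 𝓝 (1 : U)) : ∃ δ : ℝ, 0 < δ ∧ ∀ x, dist x 1 < δ → x ∈ V :=
  Metric.mem_nhds_iff.1 hV

theorem theorem1p1 {𝕜 : Type*} [RCLike 𝕜]
    {E : Type*} [NormedAddCommGroup E] [NormedSpace 𝕜 E] [CompleteSpace E]
    {U : Type*} [MetricSpace U] [ChartedSpace E U] [Group U] [LieGroup 𝓘(𝕜, E) ω U]
    (hd : IsLeftOrRightInvariantMetric U)
    (S : Set U) (hS : IsAdBounded 𝕜 (E := E) S) :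
    ∀ ε : ℝ, 0 < ε → ∃ δ : ℝ, 0 < δ ∧
      ∀ (K : Type*) [Group K] [TopologicalSpace K] [IsTopologicalGroup K] [CompactSpace K]
        (φ : K → U), Continuous φ → (∀ s, φ s ∈ S) → IsDeltaMorphism δ φ →
        ∃ ψ : K →* U, Continuous ψ ∧ ∀ s, dist (φ s) (ψ s) < ε := by
  intro ε hε
  have : IsTopologicalGroup U := topologicalGroup_of_lieGroup 𝓘(𝕜, E) ω
  let _ : NormedSpace ℝ E := NormedSpace.restrictScalars ℝ 𝕜 E
  have : IsScalarTower ℝ 𝕜 E := IsScalarTower.of_algebraMap_smul fun _ _ => rfl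
  obtain ⟨c, hc⟩ := exists_quadraticChart (𝕜 := 𝕜) (E := E) (U := U)
  obtain ⟨C₀, hC₀⟩ := hS
  have hC : 0 ≤ max C₀ 0 := le_max_right _ _
  have had : ∀ g ∈ S, ‖c.ad g‖ ≤ max C₀ 0 := fun g hg => by
    rw [hc, ContinuousLinearMap.norm_restrictScalars]
    exact (hC₀ g hg).trans (le_max_left _ _)
  have hball : ball (1 : U) ε ∈ 𝓝 (1 : U) := ball_mem_nhds _ hε
  rcases hd with hleft | hright
  -- Left invariance controls φ(st)⁻¹φ(s)φ(t), and conjugating by φ(st) turns this into the defect.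
  · obtain ⟨W, hW, hWball⟩ := c.exists_conj_mem (C := 2 * max C₀ 0) (by positivity) hball
    obtain ⟨V, hV, hφV⟩ := c.exists_morphism_near hC
      (inter_mem hW (QuadraticChart.nbhd_mem_nhds (c := c) c.r_pos))
    obtain ⟨V', hV', hVV'⟩ := c.exists_conj_mem hC hV
    obtain ⟨δ, hδ, hδV⟩ := exists_pos_forall_dist_lt (inv_mem_nhds_one U hV')
    refine ⟨δ, hδ, fun K _ _ _ _ φ hφ hφS hφδ => ?_⟩
    obtain ⟨ψ, hψ, hψW⟩ := hφV K φ hφ (fun s => had _ (hφS s)) fun s t => by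
      have h1 : ((φ (s * t))⁻¹ * (φ s * φ t)) ∈ V' := by
        have := hδV ((φ s * φ t)⁻¹ * φ (s * t)) (by
          rw [← hleft (φ s * φ t), mul_inv_cancel_left, mul_one]
          exact hφδ s t)
        simpa using this
      have := hVV' _ (had _ (hφS (s * t))) _ h1
      simpa [QuadraticChart.defect] using this
    refine ⟨ψ, hψ, fun s => ?_⟩
    -- Conjugating by φ(s)⁻¹ would need a bound on Ad(φ(s)⁻¹), which ad-boundedness of S does not
    -- give. Conjugation by ψ(s⁻¹) has the required effect, and ψ(s⁻¹) is close to φ(s⁻¹) ∈ S.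
    have h1 : ‖c.ad (ψ s⁻¹)‖ ≤ 2 * max C₀ 0 := by
      have := QuadraticChart.norm_ad_mul_le (hψW s⁻¹).2 (had _ (hφS s⁻¹))
      simpa using this
    have h2 := hWball _ h1 _ (hψW s).1
    have h3 : ψ s⁻¹ * (ψ s * (φ s)⁻¹) * (ψ s⁻¹)⁻¹ = (φ s)⁻¹ * ψ s := by simp
    rw [h3, mem_ball, ← hleft (φ s), mul_inv_cancel_left, mul_one, dist_comm] at h2
    exact h2
  · obtain ⟨V, hV, hφV⟩ := c.exists_morphism_near hC hball
    obtain ⟨δ, hδ, hδV⟩ := exists_pos_forall_dist_lt hV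
    refine ⟨δ, hδ, fun K _ _ _ _ φ hφ hφS hφδ => ?_⟩
    obtain ⟨ψ, hψ, hψW⟩ := hφV K φ hφ (fun s => had _ (hφS s)) fun s t => hδV _ (by
      have := hφδ s t
      rw [← hright (φ (s * t))⁻¹, mul_inv_cancel, dist_comm] at this
      exact this)
    refine ⟨ψ, hψ, fun s => ?_⟩
    have := hψW s
    rw [mem_ball, ← hright (φ s), inv_mul_cancel_right, one_mul, dist_comm] at this
    exact this
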